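/- Let $\mathbb K\in\{\mathbb R,\mathbb C\}$; $S_X$ denotes the unit sphere and $X^*$ the dual of a Banach space $X$. Definitions. * A Banach space $X$ over $\mathbb K$ has the *approximate hyperplane series property* (AHSp) if for every $0<\varepsilon<1$ there is $0<\eta<\varepsilon$ such that for every sequence $(x_n)$ in $S_X$ and all $0\le\alpha_n\le 1$ with $\sum_n\alpha_n=1$ and $\|\sum_n\alpha_nx_n\|>1-\eta$ there are a set $A\subset\mathbb N$, elements $z_k\in S_X$ $(k\in A)$ and $x^*\in S_{X^*}$ with $\sum_{k\in A}\alpha_k>1-\varepsilon$, and $\|z_k-x_k\|<\varepsilon$ and $x^*(z_k)=1$ for all $k\in A$. * A Banach space $X$ has the *approximate hyperplane property* (AHp) with the function $\delta:(0,1)\to(0,1)$ if there is a $1$-norming set $C\subset S_{X^*}$ (that is, $\|x\|=\sup_{x^*\in C}|x^*(x)|$ for all $x\in X$) such that for every $0<\varepsilon<1$ there is a map $\Upsilon_\varepsilon:C\to S_{X^*}$ such that $x^*\in C$, $x\in S_X$ and $\operatorname{Re}x^*(x)>1-\delta(\varepsilon)$ imply $\operatorname{dist}(x,F(\Upsilon_\varepsilon(x^*)))<\varepsilon$,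 where $F(y^*)=\{y\in S_X:\operatorname{Re}y^*(y)=1\}$ and $\operatorname{dist}(x,\emptyset)=\infty$. A family of Banach spaces has *AHp uniformly* if all its members have AHp with one common function $\delta$. * A *Banach sequence lattice* is a real Banach space $E$ that is a linear subspace of $\mathbb R^{\mathbb N}$, is solid (if $x\in\mathbb R^{\mathbb N}$, $y\in E$ and $|x_n|\le|y_n|$ for all $n$, then $x\in E$ and $\|x\|_E\le\|y\|_E$), and contains some $u$ with $u_n>0$ for all $n$. It is *uniformly monotone* if for every $\varepsilon>0$ there is $\delta>0$ such that $x\in S_E$, $y\in E$, $x,y\ge0$ and $\|x+y\|_E\le1+\delta$ imply $\|y\|_E\le\varepsilon$. * For Banach spaces $X_k$ over $\mathbb K$ $(k\in\mathbb N)$, the *$E$-sum* $\left(\bigoplus_{k=1}^\infty X_k\right)_E$ is the Banach space of all sequences $(x_k)$ with $x_k\in X_k$ and $(\|x_k\|)_k\in E$, with the norm $\|(x_k)\|=\big\|(\|x_k\|)_k\big\|_E$. Theorem. Let $E$ be a uniformly monotone Banach sequence lattice with the AHSp (as a real Banach space), and let $(X_k)_{k\in\mathbb N}$ be a sequence of nontrivial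 (that is, nonzero) Banach spaces over $\mathbb K$ that has AHp uniformly. Then $\left(\bigoplus_{k=1}^\infty X_k\right)_E$ has the AHSp. -/

import Mathlib

noncomputable section

/-- A Banach sequence lattice: a real Banach space `E` of real sequences. The inclusion of `E` into
the space `ω = (ℕ → ℝ)` of all real sequences is the injective linear map `coord`; `E` is solid and
contains a sequence all of whose terms are positive. -/
class BanachSequenceLattice (E : Type*) [NormedAddCommGroup E] [NormedSpace ℝ E] : Type _
    extends CompleteSpace E where
  coord : E →ₗ[ℝ] (ℕ → ℝ)
  coord_injective : Function.Injective coord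
  solid : ∀ (x : ℕ → ℝ) (y : E), (∀ n, |x n| ≤ |coord y n|) → ∃ z : E, coord z = x ∧ ‖z‖ ≤ ‖y‖
  exists_pos : ∃ u : E, ∀ n, 0 < coord u n

open BanachSequenceLattice in
/-- Uniform monotonicity of a Banach sequence lattice (with its coordinatewise order). -/
def UniformlyMonotone (E : Type*) [NormedAddCommGroup E] [NormedSpace ℝ E]
    [BanachSequenceLattice E] : Prop :=
  ∀ ε : ℝ, 0 < ε → ∃ δ : ℝ, 0 < δ ∧ ∀ x y : E, ‖x‖ = 1 → (∀ n, 0 ≤ coord x n) →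
    (∀ n, 0 ≤ coord y n) → ‖x + y‖ ≤ 1 + δ → ‖y‖ ≤ ε

/-- The approximate hyperplane series property (AHSp) of a Banach space `X` over `𝕜`. The series
`∑ αₙ xₙ` converges absolutely since `X` is complete. -/
def AHSp (𝕜 X : Type*) [RCLike 𝕜] [NormedAddCommGroup X] [NormedSpace 𝕜 X]
    [CompleteSpace X] : Prop :=
  ∀ ε : ℝ, 0 < ε → ε < 1 → ∃ η : ℝ, 0 < η ∧ η < ε ∧
    ∀ (x : ℕ → X) (α : ℕ → ℝ), (∀ n, ‖x n‖ = 1) → (∀ n, 0 ≤ α n ∧ α n ≤ 1) → HasSum α 1 →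
      1 - η < ‖∑' n, (α n : 𝕜) • x n‖ →
      ∃ (A : Set ℕ) (z : ℕ → X),
        1 - ε < ∑' k : A, α k ∧
        (∀ k ∈ A, ‖z k‖ = 1 ∧ ‖z k - x k‖ < ε) ∧
        ∃ f : StrongDual 𝕜 X, ‖f‖ = 1 ∧ ∀ k ∈ A, f (z k) = 1

/-- `C` is a `1`-norming subset of the unit sphere of the dual of `X`. -/
def IsOneNorming {𝕜 X : Type*} [RCLike 𝕜] [NormedAddCommGroup X] [NormedSpace 𝕜 X]
    (C : Set (StrongDual 𝕜 X)) : Prop :=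
  (∀ f ∈ C, ‖f‖ = 1) ∧ ∀ x : X, IsLUB ((fun f : StrongDual 𝕜 X => ‖f x‖) '' C) ‖x‖

/-- The face `F(f)` of the unit sphere determined by a functional `f`. -/
def sphereFace {𝕜 X : Type*} [RCLike 𝕜] [NormedAddCommGroup X] [NormedSpace 𝕜 X]
    (f : StrongDual 𝕜 X) : Set X :=
  {y : X | ‖y‖ = 1 ∧ RCLike.re (f y) = 1}

/-- The space `X` has the approximate hyperplane property (AHp) with the function
`δ : (0,1) → (0,1)`. The condition `dist (x, F(Υ f)) < ε` is spelled out as the existence of a point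
of the face at distance less than `ε` (the distance to the empty set being infinite). Only the
values of `Υ` on `C` matter. -/
def AHpWith (𝕜 X : Type*) [RCLike 𝕜] [NormedAddCommGroup X] [NormedSpace 𝕜 X]
    (δ : Set.Ioo (0 : ℝ) 1 → Set.Ioo (0 : ℝ) 1) : Prop :=
  ∃ C : Set (StrongDual 𝕜 X), IsOneNorming C ∧
    ∀ ε : Set.Ioo (0 : ℝ) 1, ∃ Υ : StrongDual 𝕜 X → StrongDual 𝕜 X,
      (∀ f ∈ C, ‖Υ f‖ = 1) ∧
      ∀ f ∈ C, ∀ x : X, ‖x‖ = 1 → 1 - (δ ε : ℝ) < RCLike.re (f x) →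
        ∃ y ∈ sphereFace (Υ f), dist x y < ε

/-- A family of spaces has AHp uniformly if all of its members have AHp with the same function. -/
def UniformlyAHp (𝕜 : Type*) [RCLike 𝕜] {I : Type*} (X : I → Type*)
    [∀ i, NormedAddCommGroup (X i)] [∀ i, NormedSpace 𝕜 (X i)] : Prop :=
  ∃ δ : Set.Ioo (0 : ℝ) 1 → Set.Ioo (0 : ℝ) 1, ∀ i, AHpWith 𝕜 (X i) δ

section ESum

open BanachSequenceLattice

/-- The space of all sequences `(x_k)` with `x_k ∈ X k`, as a plain vector space (a type synonym
without the product topology). -/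
def PreESum (X : ℕ → Type*) : Type _ := ∀ k, X k

instance (X : ℕ → Type*) [∀ k, NormedAddCommGroup (X k)] : AddCommGroup (PreESum X) :=
  inferInstanceAs (AddCommGroup (∀ k, X k))

instance (𝕜 : Type*) [RCLike 𝕜] (X : ℕ → Type*) [∀ k, NormedAddCommGroup (X k)]
    [∀ k, NormedSpace 𝕜 (X k)] : Module 𝕜 (PreESum X) :=
  inferInstanceAs (Module 𝕜 (∀ k, X k))

/-- The vector space of the `E`-sum of the sequence `X`: all `(x_k)` with `x_k ∈ X k` and
`(‖x_k‖) ∈ E`. -/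
def ESum (𝕜 E : Type*) [RCLike 𝕜] [NormedAddCommGroup E] [NormedSpace ℝ E]
    [BanachSequenceLattice E] (X : ℕ → Type*) [∀ k, NormedAddCommGroup (X k)]
    [∀ k, NormedSpace 𝕜 (X k)] : Submodule 𝕜 (PreESum X) where
  carrier := {x | ∃ e : E, coord e = fun k => ‖x k‖}
  zero_mem' := ⟨0, by
    funext k
    rw [map_zero]
    exact (norm_zero (E := X k)).symm⟩
  add_mem' := by
    rintro x y ⟨a, ha⟩ ⟨b, hb⟩
    obtain ⟨z, hz, -⟩ := solid (fun k => ‖x k + y k‖) (a + b) (fun k => by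
      rw [map_add, ha, hb, Pi.add_apply, abs_of_nonneg (norm_nonneg _),
        abs_of_nonneg (add_nonneg (norm_nonneg _) (norm_nonneg _))]
      exact norm_add_le _ _)
    exact ⟨z, hz⟩
  smul_mem' := by
    rintro c x ⟨a, ha⟩
    refine ⟨‖c‖ • a, ?_⟩
    funext k
    rw [map_smul, ha, Pi.smul_apply, smul_eq_mul]
    exact (norm_smul c (x k)).symm

variable {𝕜 E : Type*} [RCLike 𝕜] [NormedAddCommGroup E] [NormedSpace ℝ E]
  [BanachSequenceLattice E] {X : ℕ → Type*} [∀ k, NormedAddCommGroup (X k)]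
  [∀ k, NormedSpace 𝕜 (X k)]

/-- The sequence of norms `(‖x_k‖)` of a member of the `E`-sum, as an element of `E`. -/
def ESum.normSeq (x : ESum 𝕜 E X) : E := Classical.choose x.2

theorem ESum.coord_normSeq (x : ESum 𝕜 E X) :
    coord (ESum.normSeq x) = fun k => ‖x.1 k‖ := Classical.choose_spec x.2

theorem BanachSequenceLattice.norm_le_norm {a b : E} (h : ∀ k, |coord a k| ≤ |coord b k|) :
    ‖a‖ ≤ ‖b‖ := by
  obtain ⟨z, hz, hn⟩ := solid (coord a) b h
  rwa [← coord_injective hz]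

/-- The norm of the `E`-sum: `‖(x_k)‖ = ‖(‖x_k‖)‖_E`. -/
instance : Norm (ESum 𝕜 E X) := ⟨fun x => ‖ESum.normSeq x‖⟩

theorem ESum.norm_def (x : ESum 𝕜 E X) : ‖x‖ = ‖ESum.normSeq x‖ := rfl

theorem ESum.norm_le_of_le (x : ESum 𝕜 E X) (e : E) (h : ∀ k, ‖x.1 k‖ ≤ coord e k) :
    ‖x‖ ≤ ‖e‖ := by
  refine norm_le_norm fun k => ?_
  rw [ESum.coord_normSeq, abs_of_nonneg (norm_nonneg _)]
  exact (h k).trans (le_abs_self _)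

theorem ESum.normSpaceCore : NormedSpace.Core 𝕜 (ESum 𝕜 E X) where
  norm_nonneg x := norm_nonneg (ESum.normSeq x)
  norm_smul c x := by
    have : ESum.normSeq (c • x) = ‖c‖ • ESum.normSeq x := by
      apply coord_injective
      funext k
      rw [map_smul, Pi.smul_apply, ESum.coord_normSeq, ESum.coord_normSeq, smul_eq_mul]
      exact norm_smul c (x.1 k)
    rw [ESum.norm_def, ESum.norm_def, this, norm_smul, norm_norm]
  norm_triangle x y := by
    refine (ESum.norm_le_of_le (x + y) (ESum.normSeq x + ESum.normSeq y) fun k => ?_).trans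
      (norm_add_le _ _)
    rw [map_add, Pi.add_apply, ESum.coord_normSeq, ESum.coord_normSeq]
    exact norm_add_le (x.1 k) (y.1 k)
  norm_eq_zero_iff x := by
    rw [ESum.norm_def, norm_eq_zero]
    constructor
    · intro h
      apply Subtype.ext
      funext k
      have h2 := congrFun (ESum.coord_normSeq x) k
      rw [h, map_zero] at h2
      exact norm_eq_zero.1 h2.symm
    · rintro rfl
      apply coord_injective
      funext k
      rw [ESum.coord_normSeq, map_zero]
      exact norm_zero (E := X k)

instance : NormedAddCommGroup (ESum 𝕜 E X) := NormedAddCommGroup.ofCore ESum.normSpaceCore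

instance : NormedSpace 𝕜 (ESum 𝕜 E X) := NormedSpace.ofCore ESum.normSpaceCore

theorem BanachSequenceLattice.exists_coord_bound (k : ℕ) :
    ∃ c : ℝ, ∀ x : E, ‖coord x k‖ ≤ c * ‖x‖ := by
  classical
  obtain ⟨u, hu⟩ := exists_pos (E := E)
  obtain ⟨e, he, -⟩ := solid (Pi.single k (coord u k)) u (fun n => by
    by_cases h : n = k
    · subst h; simp
    · simp [h])
  have he0 : 0 < ‖e‖ := by
    rw [norm_pos_iff]
    rintro rfl
    have := congrFun he k
    simp at this
    exact (hu k).ne this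
  refine ⟨coord u k / ‖e‖, fun x => ?_⟩
  have h1 : ‖(coord x k / coord u k) • e‖ ≤ ‖x‖ := by
    refine norm_le_norm fun n => ?_
    rw [map_smul, he]
    by_cases h : n = k
    · subst h; simp [(hu n).ne']
    · simp [h]
  rw [norm_smul, norm_div, Real.norm_of_nonneg (hu k).le] at h1
  have := hu k
  calc ‖coord x k‖ = coord u k / ‖e‖ * (‖coord x k‖ / coord u k * ‖e‖) := by field_simp
    _ ≤ coord u k / ‖e‖ * ‖x‖ := by gcongr

/-- The coordinate functionals of a Banach sequence lattice are continuous. -/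
def BanachSequenceLattice.coordCLM (E : Type*) [NormedAddCommGroup E] [NormedSpace ℝ E]
    [BanachSequenceLattice E] (k : ℕ) : E →L[ℝ] ℝ :=
  LinearMap.mkContinuousOfExistsBound ((LinearMap.proj k).comp coord) (exists_coord_bound k)

theorem BanachSequenceLattice.coordCLM_apply (k : ℕ) (x : E) : coordCLM E k x = coord x k := rfl

instance [∀ k, CompleteSpace (X k)] : CompleteSpace (ESum 𝕜 E X) := by
  refine NormedAddCommGroup.completeSpace_of_summable_imp_tendsto fun x hx => ?_
  have hs : Summable fun n => ESum.normSeq (x n) := Summable.of_norm hx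
  have hk (k : ℕ) : Summable fun n => ‖(x n).1 k‖ := by
    have := hs.mapL (coordCLM E k)
    simpa only [coordCLM_apply, ESum.coord_normSeq] using this
  have htail (N k : ℕ) : coord (∑' n, ESum.normSeq (x (n + N))) k = ∑' n, ‖(x (n + N)).1 k‖ := by
    rw [← coordCLM_apply, ContinuousLinearMap.map_tsum _ ((summable_nat_add_iff N).2 hs)]
    simp only [coordCLM_apply, ESum.coord_normSeq]
  let y : PreESum X := fun k => ∑' n, (x n).1 k
  have hy : y ∈ ESum 𝕜 E X := by
    obtain ⟨z, hz, -⟩ := solid (fun k => ‖y k‖) (∑' n, ESum.normSeq (x (n + 0))) (fun k => by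
      rw [htail, abs_of_nonneg (norm_nonneg _)]
      exact (norm_tsum_le_tsum_norm (hk k)).trans (le_abs_self _))
    exact ⟨z, hz⟩
  have hsum (N k : ℕ) : (∑ n ∈ Finset.range N, x n : ESum 𝕜 E X).1 k
      = ∑ n ∈ Finset.range N, (x n).1 k := by
    induction N with
    | zero => rfl
    | succ N ih => rw [Finset.sum_range_succ, Finset.sum_range_succ, ← ih]; rfl
  refine ⟨⟨y, hy⟩, ?_⟩
  rw [tendsto_iff_norm_sub_tendsto_zero]
  refine squeeze_zero (fun _ => norm_nonneg _) (fun N => ?_)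
    (tendsto_zero_iff_norm_tendsto_zero.1 (tendsto_sum_nat_add fun n => ESum.normSeq (x n)))
  rw [norm_sub_rev]
  refine ESum.norm_le_of_le _ _ fun k => ?_
  rw [htail]
  have hd : (⟨y, hy⟩ - ∑ n ∈ Finset.range N, x n : ESum 𝕜 E X).1 k = ∑' n, (x (n + N)).1 k := by
    have h1 : (⟨y, hy⟩ - ∑ n ∈ Finset.range N, x n : ESum 𝕜 E X).1 k
        = y k - (∑ n ∈ Finset.range N, x n : ESum 𝕜 E X).1 k := rfl
    rw [h1, hsum, sub_eq_iff_eq_add', (hk k).of_norm.sum_add_tsum_nat_add N]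
  rw [hd]
  exact norm_tsum_le_tsum_norm ((summable_nat_add_iff N).2 (hk k))

end ESum

end

open BanachSequenceLattice

/-! Let `w = ∑ αₙ xₙ` have norm near `1`. AHp supplies, for each `k`, a functional `g k` almost
norming the coordinate `w_k` and a functional `h k` whose face is close to every unit vector almost
maximal for `g k`. Neither depends on `n`, so the `h k` can be assembled into one functional on the
sum.

Call `k` bad for `n` if `g k` is far from norming the `k`-th coordinate of `xₙ`. Lowering the norm
sequence of `xₙ` by a fixed proportion on bad coordinates gives `uₙ`, which still dominates the
values of the `g k`; hence `∑ αₙ ‖uₙ‖` is near `1` (`ESum.mul_norm_tsum_le`). By averaging, `‖uₙ‖`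
is near `1` for most of the weight, and for these `n` uniform monotonicity makes the bad part of
`xₙ` small.

Meanwhile AHSp of `E`, applied to the norm sequences, yields `rₙ` and `φ` with `φ(rₙ) = 1`.
Multiplying `rₙ` coordinatewise by face points of the `h k` gives the required vectors, and `φ`
composed with the `h k` attains its norm at all of them. -/

/-! ### Averaging and uniform monotonicity -/

theorem one_sub_sub_lt_tsum_inter {α a : ℕ → ℝ} {A : Set ℕ} {ε κ σ : ℝ} (hα : ∀ n, 0 ≤ α n)
    (hsum : HasSum α 1) (ha0 : ∀ n, 0 ≤ a n) (ha1 : ∀ n, a n ≤ 1) (hκ : 0 < κ)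
    (hA : 1 - ε < ∑' k : A, α k) (hσ : 1 - σ ≤ ∑' n, α n * a n) :
    1 - ε - σ / κ < ∑' k : (A ∩ {n | 1 - κ < a n} : Set ℕ), α k := by
  set G : Set ℕ := {n | 1 - κ < a n}
  have hs := hsum.summable
  have hαa : Summable fun n => α n * a n :=
    hs.of_nonneg_of_le (fun n => mul_nonneg (hα n) (ha0 n))
      fun n => mul_le_of_le_one_right (hα n) (ha1 n)
  rw [tsum_subtype A α] at hA
  rw [tsum_subtype (A ∩ G) α]
  -- Markov's inequality termwise: off `G` the deficit `1 - a n` is at least `κ`, so `α n ≤ α n * (1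
  -- - a n) / κ`.
  have key : ∑' n, (A.indicator α n + α n * a n * κ⁻¹) ≤
      ∑' n, ((A ∩ G).indicator α n + α n * κ⁻¹) := by
    refine Summable.tsum_le_tsum (fun n => ?_) ((hs.indicator A).add (hαa.mul_right _))
      ((hs.indicator _).add (hs.mul_right _))
    by_cases hn : n ∈ G
    · have h1 : (A ∩ G).indicator α n = A.indicator α n := by
        by_cases hnA : n ∈ A <;> simp [hn, hnA]
      rw [h1]
      have := mul_le_of_le_one_right (hα n) (ha1 n)
      gcongr
    · have h1 : (A ∩ G).indicator α n = 0 := by simp [hn]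
      have h2 : A.indicator α n ≤ α n := Set.indicator_le_self' (fun _ _ => hα n) n
      have h3 : a n ≤ 1 - κ := not_lt.1 hn
      have h4 : α n * a n * κ⁻¹ ≤ α n * (1 - κ) * κ⁻¹ := by
        have := hα n
        gcongr
      have h5 : α n * (1 - κ) * κ⁻¹ = α n * κ⁻¹ - α n := by field_simp
      rw [h1]
      linarith
  rw [(hs.indicator A).tsum_add (hαa.mul_right _), (hs.indicator _).tsum_add (hs.mul_right _),
    tsum_mul_right, tsum_mul_right, hsum.tsum_eq] at key
  have h6 : (1 - σ) * κ⁻¹ ≤ (∑' n, α n * a n) * κ⁻¹ := by gcongr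
  have h7 : σ / κ = 1 * κ⁻¹ - (1 - σ) * κ⁻¹ := by ring
  linarith

theorem UniformlyMonotone.exists_forall_norm_le {E : Type*} [NormedAddCommGroup E]
    [NormedSpace ℝ E] [BanachSequenceLattice E] (h : UniformlyMonotone E) {ε : ℝ} (hε : 0 < ε) :
    ∃ κ : ℝ, 0 < κ ∧ κ < 1 ∧ ∀ u p : E, (∀ k, 0 ≤ coord u k) → (∀ k, 0 ≤ coord p k) →
      1 - κ < ‖u‖ → ‖u + p‖ ≤ 1 → ‖p‖ ≤ ε := by
  obtain ⟨μ, hμ, H⟩ := h ε hε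
  -- With this `κ`, `1 - κ = 1 / (1 + μ)`, so normalising `u` brings `‖u + p‖` to at most `1 + μ`.
  refine ⟨μ / (1 + μ), by positivity, by rw [div_lt_one (by positivity)]; linarith, ?_⟩
  intro u p hu hp hn hup
  have h1 : 1 - μ / (1 + μ) = (1 + μ)⁻¹ := by field_simp; ring
  rw [h1] at hn
  have hm : 0 < ‖u‖ := lt_trans (by positivity) hn
  have hm1 : ‖u‖ ≤ 1 := by
    refine (norm_le_norm (b := u + p) fun k => ?_).trans hup
    rw [map_add, Pi.add_apply, abs_of_nonneg (hu k), abs_of_nonneg (add_nonneg (hu k) (hp k))]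
    linarith [hp k]
  have h2 := H (‖u‖⁻¹ • u) (‖u‖⁻¹ • p) (by
      rw [norm_smul, norm_inv, norm_norm, inv_mul_cancel₀ hm.ne'])
    (fun k => by rw [map_smul]; exact mul_nonneg (by positivity) (hu k))
    (fun k => by rw [map_smul]; exact mul_nonneg (by positivity) (hp k))
    (by
      rw [← smul_add, norm_smul, norm_inv, norm_norm]
      have h3 : ‖u‖⁻¹ ≤ 1 + μ := by
        rw [inv_le_comm₀ hm (by positivity)]; exact hn.le
      calc ‖u‖⁻¹ * ‖u + p‖ ≤ (1 + μ) * 1 := by gcongr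
        _ = 1 + μ := mul_one _)
  rw [norm_smul, norm_inv, norm_norm] at h2
  calc ‖p‖ = ‖u‖ * (‖u‖⁻¹ * ‖p‖) := by field_simp
    _ ≤ 1 * ε := by gcongr
    _ = ε := one_mul ε

theorem RCLike.eq_one_of_re_eq_one {𝕜 : Type*} [RCLike 𝕜] {z : 𝕜} (hz : ‖z‖ ≤ 1)
    (hre : RCLike.re z = 1) : z = 1 := by
  have := RCLike.re_eq_self_of_le (a := z) (by rw [hre]; exact hz)
  rw [← this, hre, RCLike.ofReal_one]

/-! ### Almost norming functionals and their faces -/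

section AHp

variable {𝕜 X : Type*} [RCLike 𝕜] [NormedAddCommGroup X] [NormedSpace 𝕜 X]

/-- A unit functional has real part at unit vectors arbitrarily close to `1`. -/
theorem StrongDual.exists_norm_eq_one_lt_re {f : StrongDual 𝕜 X} (hf : ‖f‖ = 1) {r : ℝ}
    (hr : r < 1) : ∃ x : X, ‖x‖ = 1 ∧ r < RCLike.re (f x) := by
  have h0 : max r 0 < ‖f‖ := by rw [hf]; exact max_lt hr one_pos
  obtain ⟨x, hx, hrx⟩ := f.exists_lt_apply_of_lt_opNorm h0
  have hfx : 0 < ‖f x‖ := (le_max_right r 0).trans_lt hrx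
  have hx0 : 0 < ‖x‖ := by
    rw [norm_pos_iff]
    rintro rfl
    simp at hfx
  obtain ⟨c, hc, hcx⟩ := RCLike.exists_norm_eq_mul_self (f x)
  refine ⟨c • ((‖x‖⁻¹ : ℝ) : 𝕜) • x, ?_, ?_⟩
  · rw [norm_smul, norm_smul, hc, RCLike.norm_ofReal, abs_of_pos (inv_pos.2 hx0),
      inv_mul_cancel₀ hx0.ne', one_mul]
  · rw [f.map_smul, f.map_smul, smul_eq_mul, smul_eq_mul, mul_left_comm, ← hcx, ← RCLike.ofReal_mul,
      RCLike.ofReal_re]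
    have h1 : 1 ≤ ‖x‖⁻¹ := (one_le_inv₀ hx0).2 hx.le
    exact ((le_max_left r 0).trans_lt hrx).trans_le (le_mul_of_one_le_left hfx.le h1)

/-- In a space with AHp, every vector `w` is almost normed by a functional `g` for which almost
maximal points are close to the face of another functional `h`; the face is nonempty. -/
theorem AHpWith.exists_almost_norming [Nontrivial X] {δ : Set.Ioo (0 : ℝ) 1 → Set.Ioo (0 : ℝ) 1}
    (H : AHpWith 𝕜 X δ) (ε : Set.Ioo (0 : ℝ) 1) {η : ℝ} (hη : 0 < η) (w : X) :
    ∃ g h : StrongDual 𝕜 X, ‖g‖ = 1 ∧ ‖h‖ = 1 ∧ (1 - η) * ‖w‖ ≤ RCLike.re (g w) ∧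
      ∀ x : X, ∃ y : X, ‖y‖ = 1 ∧ h y = 1 ∧
        ((1 - (δ ε : ℝ)) * ‖x‖ < RCLike.re (g x) →
          ‖(‖x‖ : 𝕜) • y - x‖ ≤ ε * ‖x‖) := by
  obtain ⟨C, ⟨hC1, hC⟩, hΥ⟩ := H
  obtain ⟨Υ, hΥ1, hΥ⟩ := hΥ ε
  have hf : ∃ f ∈ C, (1 - η) * ‖w‖ ≤ ‖f w‖ := by
    -- For `w = 0` only a member of `C` is needed; there is one because the image of `C` has a
    -- supremum in `ℝ`.
    by_cases hw : w = 0
    · obtain ⟨v, hv⟩ := exists_ne (0 : X)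
      obtain ⟨_, ⟨f, hfC, rfl⟩, -⟩ := (lt_isLUB_iff (hC v)).1 (sub_one_lt ‖v‖)
      exact ⟨f, hfC, by simp [hw]⟩
    · have hw' : 0 < ‖w‖ := norm_pos_iff.2 hw
      obtain ⟨_, ⟨f, hfC, rfl⟩, hlt⟩ :=
        (lt_isLUB_iff (hC w)).1 (show (1 - η) * ‖w‖ < ‖w‖ by nlinarith)
      exact ⟨f, hfC, hlt.le⟩
  obtain ⟨f, hfC, hfw⟩ := hf
  -- Rotating `f` and `Υ f` by the same unimodular `c` makes the value at `w` real; AHp is then used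
  -- at `c • x` and its face point rotated back.
  obtain ⟨c, hc, hcw⟩ := RCLike.exists_norm_eq_mul_self (f w)
  have hc0 : c ≠ 0 := by rintro rfl; simp at hc
  have hΥle : ∀ y : X, ‖y‖ = 1 → ‖Υ f y‖ ≤ 1 := fun y hy => by
    have := (Υ f).le_opNorm y
    rwa [hΥ1 f hfC, hy, mul_one] at this
  have key : ∀ x : X, ‖x‖ = 1 → 1 - (δ ε : ℝ) < RCLike.re ((c • f) x) →
      ∃ y : X, ‖y‖ = 1 ∧ (c • Υ f) y = 1 ∧ ‖y - x‖ ≤ ε := by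
    intro x hx hgx
    obtain ⟨y, ⟨hy1, hy⟩, hd⟩ := hΥ f hfC (c • x) (by rw [norm_smul, hc, hx, one_mul])
      (by simpa using hgx)
    refine ⟨c⁻¹ • y, by rw [norm_smul, norm_inv, hc, hy1, inv_one, one_mul], ?_, ?_⟩
    · rw [_root_.smul_apply, map_smul, smul_smul, mul_inv_cancel₀ hc0, one_smul]
      exact RCLike.eq_one_of_re_eq_one (hΥle y hy1) hy
    · rw [dist_comm, dist_eq_norm] at hd
      have : c⁻¹ • y - x = c⁻¹ • (y - c • x) := by
        rw [smul_sub, smul_smul, inv_mul_cancel₀ hc0, one_smul]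
      rw [this, norm_smul, norm_inv, hc, inv_one, one_mul]
      exact hd.le
  have hg1 : ‖c • f‖ = 1 := by rw [norm_smul, hc, hC1 f hfC, one_mul]
  refine ⟨c • f, c • Υ f, hg1, by rw [norm_smul, hc, hΥ1 f hfC, one_mul], ?_, fun x => ?_⟩
  · rw [_root_.smul_apply, smul_eq_mul, ← hcw, RCLike.ofReal_re]
    exact hfw
  · by_cases hx : (1 - (δ ε : ℝ)) * ‖x‖ < RCLike.re ((c • f) x)
    · have hx0 : 0 < ‖x‖ := by
        rw [norm_pos_iff]
        rintro rfl
        simp at hx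
      obtain ⟨y, hy1, hy, hd⟩ := key (((‖x‖⁻¹ : ℝ) : 𝕜) • x)
        (by rw [norm_smul, RCLike.norm_ofReal, abs_of_pos (inv_pos.2 hx0),
          inv_mul_cancel₀ hx0.ne'])
        (by
          rw [map_smul, smul_eq_mul, RCLike.re_ofReal_mul, inv_mul_eq_div, lt_div_iff₀ hx0]
          exact hx)
      refine ⟨y, hy1, hy, fun _ => ?_⟩
      have : (‖x‖ : 𝕜) • y - x = (‖x‖ : 𝕜) • (y - ((‖x‖⁻¹ : ℝ) : 𝕜) • x) := by
        rw [smul_sub, smul_smul, ← RCLike.ofReal_mul, mul_inv_cancel₀ hx0.ne', RCLike.ofReal_one,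
          one_smul]
      rw [this, norm_smul, RCLike.norm_ofReal, abs_norm, mul_comm]
      gcongr
    -- The implication is void here, but a face point is still required; any almost maximal vector
    -- of `g` provides one.
    · obtain ⟨x', hx', hlt⟩ := StrongDual.exists_norm_eq_one_lt_re hg1
        (show 1 - (δ ε : ℝ) < 1 by linarith [(δ ε).2.1])
      obtain ⟨y, hy1, hy, -⟩ := key x' hx' hlt
      exact ⟨y, hy1, hy, fun h => absurd h hx⟩

end AHp

/-! ### Vectors and functionals on the `E`-sum -/

namespace ESum

variable {𝕜 E : Type*} [RCLike 𝕜] [NormedAddCommGroup E] [NormedSpace ℝ E]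
  [BanachSequenceLattice E] {X : ℕ → Type*} [∀ k, NormedAddCommGroup (X k)]
  [∀ k, NormedSpace 𝕜 (X k)]

/-- Solidity makes the norm of `E` depend on absolute values only. Signs must be allowed in `e`,
since AHSp of `E` gives no positivity. -/
theorem exists_norm_eq (x : ∀ k, X k) (e : E) (h : ∀ k, ‖x k‖ = |coord e k|) :
    ∃ z : ESum 𝕜 E X, (∀ k, z.1 k = x k) ∧ ‖z‖ = ‖e‖ := by
  obtain ⟨a, ha, -⟩ := solid (fun k => ‖x k‖) e fun k => by rw [abs_norm, h]
  refine ⟨⟨x, a, ha⟩, fun k => rfl, le_antisymm ?_ ?_⟩ <;> rw [norm_def]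
  · refine norm_le_norm fun k => ?_
    rw [coord_normSeq, abs_norm]
    exact (h k).le
  · refine norm_le_norm fun k => ?_
    rw [coord_normSeq, abs_norm]
    exact (h k).ge

variable (𝕜 E X) in
/-- The coordinate projections of the `E`-sum are continuous. -/
noncomputable def projCLM (k : ℕ) : ESum 𝕜 E X →L[𝕜] X k :=
  LinearMap.mkContinuousOfExistsBound
    { toFun := fun x => x.1 k, map_add' := fun _ _ => rfl, map_smul' := fun _ _ => rfl } (by
      obtain ⟨c, hc⟩ := exists_coord_bound (E := E) k
      refine ⟨c, fun x => ?_⟩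
      have := hc (normSeq x)
      rwa [coord_normSeq, norm_norm] at this)

theorem projCLM_apply (k : ℕ) (x : ESum 𝕜 E X) : projCLM 𝕜 E X k x = x.1 k := rfl

/-- Functionals `h k` on the summands and a functional `φ` on `E` combine to a functional on the
`E`-sum. -/
theorem exists_functional (h : ∀ k, StrongDual 𝕜 (X k)) (hh : ∀ k, ‖h k‖ ≤ 1)
    (φ : StrongDual ℝ E) : ∃ F : StrongDual 𝕜 (ESum 𝕜 E X), ‖F‖ ≤ ‖φ‖ ∧
      ∀ (z : ESum 𝕜 E X) (r : E), (∀ k, coord r k = RCLike.re (h k (z.1 k))) →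
        RCLike.re (F z) = φ r := by
  let _ : NormedSpace ℝ (ESum 𝕜 E X) := NormedSpace.restrictScalars ℝ 𝕜 _
  have _ : IsScalarTower ℝ 𝕜 (ESum 𝕜 E X) := RestrictScalars.isScalarTower ℝ 𝕜 (ESum 𝕜 E X)
  have hle : ∀ (z : ESum 𝕜 E X) (k : ℕ), |RCLike.re (h k (z.1 k))| ≤ ‖z.1 k‖ := fun z k =>
    (RCLike.abs_re_le_norm _).trans <| ((h k).le_opNorm _).trans <|
      mul_le_of_le_one_left (norm_nonneg _) (hh k)
  have hex : ∀ z : ESum 𝕜 E X, ∃ r : E, (coord r = fun k => RCLike.re (h k (z.1 k))) ∧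
      ‖r‖ ≤ ‖z‖ := fun z =>
    solid _ (normSeq z) fun k => by rw [coord_normSeq, abs_norm]; exact hle z k
  choose S hS hSn using hex
  -- The real functional `z ↦ φ((Re h k (z k))_k)`, later extended to a `𝕜`-linear one with this
  -- real part and the same norm.
  let fr : StrongDual ℝ (ESum 𝕜 E X) := LinearMap.mkContinuous
    { toFun := fun z => φ (S z)
      map_add' := fun x y => by
        rw [← map_add]
        congr 1
        apply coord_injective
        funext k
        rw [map_add, Pi.add_apply, hS, hS, hS, ← map_add, ← map_add]
        rfl
      map_smul' := fun c x => by
        rw [RingHom.id_apply, ← map_smul]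
        congr 1
        apply coord_injective
        funext k
        rw [map_smul, Pi.smul_apply, hS, hS, smul_eq_mul, ← RCLike.re_ofReal_mul, ← smul_eq_mul,
          ← (h k).map_smul]
        change RCLike.re (h k (projCLM 𝕜 E X k (c • x))) = _
        rw [RCLike.real_smul_eq_coe_smul (K := 𝕜), ContinuousLinearMap.map_smul]
        rfl }
    ‖φ‖ fun z => (φ.le_opNorm _).trans (by gcongr; exact hSn z)
  refine ⟨fr.extendRCLike, ?_, fun z r hr => ?_⟩
  · rw [StrongDual.norm_extendRCLike]
    exact LinearMap.mkContinuous_norm_le _ (norm_nonneg _) _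
  · rw [StrongDual.re_extendRCLike_apply]
    have : S z = r := coord_injective (by rw [hS]; exact (funext hr).symm)
    rw [← this]
    rfl

end ESum

/-! ### Damping, transfer and convex series -/

section

variable {𝕜 E : Type*} [RCLike 𝕜] [NormedAddCommGroup E] [NormedSpace ℝ E]
  [BanachSequenceLattice E] {X : ℕ → Type*} [∀ k, NormedAddCommGroup (X k)]
  [∀ k, NormedSpace 𝕜 (X k)]

/-- Damping the coordinates of a member of the `E`-sum at which the functional `g k` is far from
being attained. -/
theorem ESum.exists_damped (g : ∀ k, StrongDual 𝕜 (X k)) (hg : ∀ k, ‖g k‖ = 1) {δ : ℝ}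
    (hδ0 : 0 < δ) (hδ1 : δ < 1) (x : ESum 𝕜 E X) :
    ∃ u p : E, u + δ • p = normSeq x ∧ (∀ k, 0 ≤ coord u k) ∧ (∀ k, 0 ≤ coord p k) ∧
      (∀ k, RCLike.re (g k (x.1 k)) ≤ coord u k) ∧
      ∀ k, (1 - δ) * ‖x.1 k‖ < RCLike.re (g k (x.1 k)) ∨ coord p k = ‖x.1 k‖ := by
  classical
  -- `p` carries the bad coordinates; there `u` equals `(1 - δ) * ‖x k‖`, which badness says still
  -- dominates `g k`.
  obtain ⟨p, hp, -⟩ := solid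
    (fun k => if (1 - δ) * ‖x.1 k‖ < RCLike.re (g k (x.1 k)) then 0 else ‖x.1 k‖)
    (normSeq x) fun k => by
      rw [coord_normSeq, abs_norm]
      split_ifs <;> simp
  have hre : ∀ k, RCLike.re (g k (x.1 k)) ≤ ‖x.1 k‖ := fun k => by
    have := (g k).le_opNorm (x.1 k)
    rw [hg, one_mul] at this
    exact (RCLike.re_le_norm _).trans this
  have hu : ∀ k, coord (normSeq x - δ • p) k = ‖x.1 k‖ - δ * coord p k := fun k => by
    rw [map_sub, Pi.sub_apply, map_smul, coord_normSeq]
    rfl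
  refine ⟨normSeq x - δ • p, p, sub_add_cancel _ _, fun k => ?_, fun k => ?_, fun k => ?_,
    fun k => ?_⟩
  · rw [hu, hp]
    dsimp only
    split_ifs <;> nlinarith [norm_nonneg (x.1 k)]
  · rw [hp]
    dsimp only
    split_ifs <;> simp
  · rw [hu, hp]
    dsimp only
    split_ifs with h
    · simpa using hre k
    · linarith
  · rw [hp]
    dsimp only
    split_ifs with h
    · exact Or.inl h
    · exact Or.inr rfl

/-- Transfer of a unit vector `r` of `E` near the norm sequence of `x` to the `E`-sum. -/
theorem ESum.exists_norm_eq_near (x : ESum 𝕜 E X) (r p : E) (y : ∀ k, X k) {ε : ℝ} (hε : 0 ≤ ε)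
    (hy : ∀ k, ‖y k‖ = 1) (hp : ∀ k, 0 ≤ coord p k)
    (hxy : ∀ k, ‖(‖x.1 k‖ : 𝕜) • y k - x.1 k‖ ≤ ε * ‖x.1 k‖ ∨ coord p k = ‖x.1 k‖) :
    ∃ z : ESum 𝕜 E X, (∀ k, z.1 k = (coord r k : 𝕜) • y k) ∧ ‖z‖ = ‖r‖ ∧
      ‖z - x‖ ≤ ‖r - normSeq x‖ + ε * ‖x‖ + 2 * ‖p‖ := by
  obtain ⟨z, hz, hzn⟩ := ESum.exists_norm_eq (𝕜 := 𝕜) (fun k => (coord r k : 𝕜) • y k) r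
    fun k => by rw [norm_smul, hy, mul_one, RCLike.norm_ofReal]
  refine ⟨z, hz, hzn, ?_⟩
  obtain ⟨d, hd, hdn⟩ := solid (fun k => |coord (r - normSeq x) k|) (r - normSeq x)
    fun k => by rw [abs_abs]
  -- Three errors: `r` against the norm sequence, the face approximation on good coordinates, and
  -- the trivial bound `2 * ‖x k‖` on the coordinates carried by `p`.
  refine (ESum.norm_le_of_le (z - x) (d + ε • normSeq x + (2 : ℝ) • p) fun k => ?_).trans ?_
  · have h1 : (z - x).1 k = ((coord r k - ‖x.1 k‖ : ℝ) : 𝕜) • y k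
        + ((‖x.1 k‖ : 𝕜) • y k - x.1 k) := by
      have : (z - x).1 k = z.1 k - x.1 k := rfl
      rw [this, hz, RCLike.ofReal_sub, sub_smul]
      abel
    have h2 : coord (d + ε • normSeq x + (2 : ℝ) • p) k
        = |coord r k - ‖x.1 k‖| + ε * ‖x.1 k‖ + 2 * coord p k := by
      rw [map_add, map_add, map_smul, map_smul, Pi.add_apply, Pi.add_apply, hd, map_sub,
        coord_normSeq]
      rfl
    have h3 : ‖((coord r k - ‖x.1 k‖ : ℝ) : 𝕜) • y k‖ = |coord r k - ‖x.1 k‖| := by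
      rw [norm_smul, hy, mul_one, RCLike.norm_ofReal]
    rw [h1, h2]
    refine (norm_add_le _ _).trans ?_
    rw [h3, add_assoc]
    gcongr
    rcases hxy k with h | h
    · linarith [hp k]
    · have h4 : ‖(‖x.1 k‖ : 𝕜) • y k‖ = ‖x.1 k‖ := by
        rw [norm_smul, hy, mul_one, RCLike.norm_ofReal, abs_norm]
      have h5 := norm_sub_le ((‖x.1 k‖ : 𝕜) • y k) (x.1 k)
      rw [h4] at h5
      have := mul_nonneg hε (norm_nonneg (x.1 k))
      linarith
  · refine (norm_add₃_le).trans ?_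
    rw [norm_smul, norm_smul, Real.norm_of_nonneg hε, Real.norm_of_nonneg zero_le_two,
      ← ESum.norm_def]
    gcongr

/-- If the functionals `g k` almost norm the coordinates of a convex series `∑ αₙ xₙ`, and `u n`
dominates the values of the functionals along `x n`, then `∑ αₙ ‖u n‖` almost dominates the norm of
the series. -/
theorem ESum.mul_norm_tsum_le [∀ k, CompleteSpace (X k)] {α : ℕ → ℝ} (hα : ∀ n, 0 ≤ α n)
    (hs : Summable α) {x : ℕ → ESum 𝕜 E X} (hx : ∀ n, ‖x n‖ ≤ 1) {u : ℕ → E}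
    (hu : ∀ n, ‖u n‖ ≤ 1) (g : ∀ k, StrongDual 𝕜 (X k)) {c : ℝ} (hc : 0 ≤ c)
    (hg : ∀ k, c * ‖(∑' n, (α n : 𝕜) • x n : ESum 𝕜 E X).1 k‖ ≤
      RCLike.re (g k ((∑' n, (α n : 𝕜) • x n : ESum 𝕜 E X).1 k)))
    (hgu : ∀ n k, RCLike.re (g k ((x n).1 k)) ≤ coord (u n) k) :
    c * ‖∑' n, (α n : 𝕜) • x n‖ ≤ ∑' n, α n * ‖u n‖ := by
  have hsx : Summable fun n => (α n : 𝕜) • x n := .of_norm_bounded hs fun n => by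
    rw [norm_smul, RCLike.norm_ofReal, abs_of_nonneg (hα n)]
    exact mul_le_of_le_one_right (hα n) (hx n)
  have hun : Summable fun n => ‖α n • u n‖ := hs.of_nonneg_of_le (fun _ => norm_nonneg _) fun n => by
    rw [norm_smul, Real.norm_of_nonneg (hα n)]
    exact mul_le_of_le_one_right (hα n) (hu n)
  have hsu : Summable fun n => α n • u n := hun.of_norm
  set w : ESum 𝕜 E X := ∑' n, (α n : 𝕜) • x n
  have hcoord : ∀ k, c * ‖w.1 k‖ ≤ coord (∑' n, α n • u n) k := fun k => by
    refine (hg k).trans ?_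
    have h1 := ((hsx.hasSum.mapL (projCLM 𝕜 E X k)).mapL (g k)).mapL (RCLike.reCLM (K := 𝕜))
    have h2 := hsu.hasSum.mapL (coordCLM E k)
    refine hasSum_le (fun n => ?_) h1 h2
    rw [map_smul, (g k).map_smul, (coordCLM E k).map_smul, coordCLM_apply, projCLM_apply,
      RCLike.reCLM_apply, smul_eq_mul, RCLike.re_ofReal_mul]
    exact mul_le_mul_of_nonneg_left (hgu n k) (hα n)
  calc c * ‖w‖ = ‖c • normSeq w‖ := by rw [norm_smul, Real.norm_of_nonneg hc, norm_def]
    _ ≤ ‖∑' n, α n • u n‖ := norm_le_norm fun k => by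
      have h0 : coord (c • normSeq w) k = c * ‖w.1 k‖ := by
        rw [map_smul, coord_normSeq]
        rfl
      rw [h0, abs_of_nonneg (by positivity)]
      exact (hcoord k).trans (le_abs_self _)
    _ ≤ ∑' n, ‖α n • u n‖ := norm_tsum_le_tsum_norm hun
    _ = ∑' n, α n * ‖u n‖ := by
      congr 1
      funext n
      rw [norm_smul, Real.norm_of_nonneg (hα n)]

/-- The triangle inequality in each coordinate; it lets AHSp of `E` be applied to the norm
sequences. -/
theorem ESum.norm_tsum_le_norm_tsum_normSeq [∀ k, CompleteSpace (X k)] {α : ℕ → ℝ}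
    (hα : ∀ n, 0 ≤ α n) (hs : Summable α) {x : ℕ → ESum 𝕜 E X} (hx : ∀ n, ‖x n‖ ≤ 1) :
    ‖∑' n, (α n : 𝕜) • x n‖ ≤ ‖∑' n, α n • normSeq (x n)‖ := by
  have hsx : Summable fun n => ‖(α n : 𝕜) • x n‖ :=
    hs.of_nonneg_of_le (fun _ => norm_nonneg _) fun n => by
      rw [norm_smul, RCLike.norm_ofReal, abs_of_nonneg (hα n)]
      exact mul_le_of_le_one_right (hα n) (hx n)
  have hsu : Summable fun n => α n • normSeq (x n) := .of_norm_bounded hs fun n => by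
    rw [norm_smul, Real.norm_of_nonneg (hα n), ← norm_def]
    exact mul_le_of_le_one_right (hα n) (hx n)
  refine ESum.norm_le_of_le _ _ fun k => ?_
  have h1 := hsx.of_norm.hasSum.mapL (projCLM 𝕜 E X k)
  have h2 := hsu.hasSum.mapL (coordCLM E k)
  rw [projCLM_apply] at h1
  rw [coordCLM_apply] at h2
  rw [← h1.tsum_eq]
  refine tsum_of_norm_bounded h2 fun n => ?_
  rw [map_smul, map_smul, coordCLM_apply, projCLM_apply, coord_normSeq, norm_smul,
    RCLike.norm_ofReal, abs_of_nonneg (hα n), smul_eq_mul]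

end

/-! ### The main theorem -/

theorem theorem2p9 {𝕜 E : Type*} [RCLike 𝕜] [NormedAddCommGroup E] [NormedSpace ℝ E]
    [BanachSequenceLattice E] (X : ℕ → Type*) [∀ k, NormedAddCommGroup (X k)]
    [∀ k, NormedSpace 𝕜 (X k)] [∀ k, CompleteSpace (X k)] [∀ k, Nontrivial (X k)]
    (hE : AHSp ℝ E) (hmono : UniformlyMonotone E) (hX : UniformlyAHp 𝕜 X) :
    AHSp 𝕜 (ESum 𝕜 E X) := by
  intro ε hε hε1
  obtain ⟨δ, hδ⟩ := hX
  let ε₁ : Set.Ioo (0 : ℝ) 1 := ⟨ε / 4, by linarith, by linarith⟩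
  have hd0 : 0 < (δ ε₁ : ℝ) := (δ ε₁).2.1
  have hd1 : (δ ε₁ : ℝ) < 1 := (δ ε₁).2.2
  set d : ℝ := (δ ε₁ : ℝ)
  -- Monotonicity will bound `d • p n`, hence the factor `d`. The distance budget is `ε / 4` from
  -- `E`, `ε / 4` from the faces and `2 * (ε / 8)` from the bad part.
  obtain ⟨κ, hκ0, hκ1, hκ⟩ := hmono.exists_forall_norm_le (ε := d * (ε / 8)) (by positivity)
  obtain ⟨ηE, hηE0, hηE1, hηE⟩ := hE (ε / 4) (by linarith) (by linarith)
  -- The second term makes the weight lost in averaging, `2 * η / κ`, at most `ε / 4`.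
  have hη0 : 0 < min ηE (κ * ε / 8) := lt_min hηE0 (by positivity)
  have hη1 : min ηE (κ * ε / 8) ≤ ηE := min_le_left _ _
  have hη2 : min ηE (κ * ε / 8) ≤ κ * ε / 8 := min_le_right _ _
  refine ⟨min ηE (κ * ε / 8), hη0, by linarith, ?_⟩
  set η := min ηE (κ * ε / 8)
  intro x α hx hα hsum hw
  have hα0 := fun n => (hα n).1
  have hx1 := fun n => (hx n).le
  choose g h hg hh hgw hgh using fun k => (hδ k).exists_almost_norming ε₁ hη0
    ((∑' n, (α n : 𝕜) • x n : ESum 𝕜 E X).1 k)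
  choose u p hup hu0 hp0 hgu hgp using fun n => ESum.exists_damped g hg hd0 hd1 (x n)
  choose y hy1 hhy hyx using hgh
  have hup1 : ∀ n, ‖u n + d • p n‖ = 1 := fun n => by rw [hup, ← ESum.norm_def, hx]
  have hdp0 : ∀ n k, 0 ≤ coord (d • p n) k := fun n k => by
    rw [map_smul]
    exact mul_nonneg hd0.le (hp0 n k)
  have hu1 : ∀ n, ‖u n‖ ≤ 1 := fun n => by
    rw [← hup1 n]
    refine BanachSequenceLattice.norm_le_norm fun k => ?_
    rw [map_add, Pi.add_apply, abs_of_nonneg (hu0 n k),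
      abs_of_nonneg (add_nonneg (hu0 n k) (hdp0 n k))]
    linarith [hdp0 n k]
  -- One factor `1 - η` comes from the almost norming `g k`, the other from `‖w‖ > 1 - η`.
  have hlow : 1 - 2 * η ≤ ∑' n, α n * ‖u n‖ := by
    refine le_trans ?_ (ESum.mul_norm_tsum_le hα0 hsum.summable hx1 hu1 g
      (c := 1 - η) (by linarith) hgw hgu)
    nlinarith
  obtain ⟨A, r, hA, hr, φ, hφ, hφr⟩ := hηE (fun n => ESum.normSeq (x n)) α
    (fun n => by rw [← ESum.norm_def, hx]) hα hsum ((sub_le_sub_left hη1 1).trans_lt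
      (hw.trans_le (ESum.norm_tsum_le_norm_tsum_normSeq hα0 hsum.summable hx1)))
  have hAG := one_sub_sub_lt_tsum_inter hα0 hsum (fun n => norm_nonneg (u n)) hu1 hκ0 hA hlow
  have hηκ : 2 * η / κ ≤ ε / 4 := by
    rw [div_le_iff₀ hκ0]
    linarith
  have hz : ∀ n, ∃ z : ESum 𝕜 E X,
      (∀ k, z.1 k = (BanachSequenceLattice.coord (r n) k : 𝕜) • y k ((x n).1 k)) ∧
      ‖z‖ = ‖r n‖ ∧ ‖z - x n‖ ≤ ‖r n - ESum.normSeq (x n)‖ + ε / 4 * ‖x n‖ + 2 * ‖p n‖ :=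
    fun n => ESum.exists_norm_eq_near (x n) (r n) (p n) _ (by linarith)
      (fun k => hy1 k _) (hp0 n) fun k => (hgp n k).imp_left (hyx k _)
  choose z hzk hzn hzx using hz
  obtain ⟨F, hF, hFr⟩ := ESum.exists_functional (E := E) h (fun k => (hh k).le) φ
  rw [hφ] at hF
  have hFz : ∀ n ∈ A, F (z n) = 1 := fun n hn => by
    refine RCLike.eq_one_of_re_eq_one ?_ ?_
    · have := F.le_opNorm (z n)
      rw [hzn, (hr n hn).1, mul_one] at this
      exact this.trans hF
    · rw [← hφr n hn]
      refine hFr _ _ fun k => ?_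
      rw [hzk, (h k).map_smul, hhy, smul_eq_mul, mul_one, RCLike.ofReal_re]
  refine ⟨A ∩ {n | 1 - κ < ‖u n‖}, z, by linarith, ?_, F, ?_, fun k hk => hFz k hk.1⟩
  · rintro n ⟨hnA, hnG⟩
    refine ⟨(hzn n).trans (hr n hnA).1, (hzx n).trans_lt ?_⟩
    have h1 := hκ (u n) (d • p n) (hu0 n) (hdp0 n) hnG (hup1 n).le
    rw [norm_smul, Real.norm_of_nonneg hd0.le] at h1
    have h2 := le_of_mul_le_mul_left h1 hd0
    have h3 := (hr n hnA).2
    rw [hx]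
    linarith
  -- A single `z n` of norm one with `F (z n) = 1` forces `‖F‖ ≥ 1`.
  · obtain ⟨n, hn⟩ : A.Nonempty := by
      rw [Set.nonempty_iff_ne_empty]
      rintro rfl
      simp at hA
      linarith
    refine le_antisymm hF ?_
    have := F.le_opNorm (z n)
    rwa [hFz n hn, hzn, (hr n hn).1, mul_one, norm_one] at this
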